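/- Let $\nu>0$ and $\alpha\in(\tfrac14,1]$, and let $u=u(t,x)$ be a real classical solution, for $0<t<T$, of the fractional Burgers equation $$u_t+u\,u_x+\nu\,(-\Delta)^\alpha u=0,$$ $1$-periodic in $x$, where $(-\Delta)^\alpha$ is defined on $1$-periodic functions by multiplying the $k$-th Fourier coefficient, $k\in\mathbb Z$, by $(2\pi|k|)^{2\alpha}$. (Classical: $u,u_t,u_x,u_{xx}$ exist and are continuous in $(t,x)$, $(-\Delta)^\alpha u(t,\cdot)$ is a continuous function, and the equation holds at every point.) Let $$\mathcal E(u)=\frac12\int_0^1|u_x|^2\,dx .$$ Then $t\mapsto\mathcal E(u(t))$ is differentiable on $(0,T)$ and, for every $t\in(0,T)$, $$\frac{d\mathcal E}{dt}\le\sigma_1\,\mathcal E^{\gamma_1},\qquad \gamma_1=\frac{6\alpha-1}{4\alpha-1},$$ where $$\sigma_1=\begin{cases} \dfrac{4\alpha-1}{(2\alpha-1)\,2^{\frac{2\alpha+1}{4\alpha-1}}\,\nu^{\frac1{4\alpha-1}}\,\pi^{\frac{2\alpha}{4\alpha-1}}}, & \tfrac12<\alpha\le1,\\[3ex] \dfrac1{2\nu},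 & \alpha=\tfrac12,\\[2ex] \dfrac{4\alpha-1}{2^{\frac{8\alpha+1}{4\alpha-1}}\,\pi^{\frac{2\alpha}{4\alpha-1}}\,\alpha^{\frac{4\alpha}{4\alpha-1}}\,\nu^{\frac1{4\alpha-1}}}\left[\dfrac{\Gamma\left(\frac{1-\alpha}2\right)}{\Gamma\left(\frac{1+\alpha}2\right)}\right]^{\frac2{4\alpha-1}}, & \tfrac14<\alpha<\tfrac12 . \end{cases}$$ -/

import Mathlib

noncomputable section

namespace FracBurgers

/-- The `k`-th Fourier coefficient `∫₀¹ f(x) e^{-2πikx} dx` of a real function on `[0,1]`. -/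
def coeff (f : ℝ → ℝ) (k : ℤ) : ℂ :=
  fourierCoeffOn (zero_lt_one : (0 : ℝ) < 1) (fun x => (f x : ℂ)) k

/-- `w = (-Δ)^α v` for 1-periodic `v`: the function `w` is continuous and 1-periodic, and its
Fourier coefficients are those of `v` multiplied by `(2π|k|)^{2α}`. Such a `w` is unique, as a
continuous periodic function is determined by its Fourier coefficients. -/
structure IsFracLaplacian (α : ℝ) (v w : ℝ → ℝ) : Prop where
  continuous : Continuous w
  periodic : Function.Periodic w 1
  coeff_eq : ∀ k : ℤ, coeff w k = (((2 * Real.pi * |(k : ℝ)|) ^ (2 * α) : ℝ) : ℂ) * coeff v k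

/-- Classical solutions `u = u(t, x)`, for `0 < t < T`, of the 1-periodic fractional Burgers
equation `u_t + u u_x + ν (-Δ)^α u = 0`: the derivatives `u_t`, `u_x`, `u_xx` exist and, like `u`,
are continuous in `(t, x)`, and the equation holds at every point. -/
structure IsClassicalSolution (ν α T : ℝ) (u : ℝ → ℝ → ℝ) : Prop where
  periodic : ∀ t ∈ Set.Ioo 0 T, Function.Periodic (u t) 1
  contDiff_space : ∀ t ∈ Set.Ioo 0 T, ContDiff ℝ 2 (u t)
  differentiable_time : ∀ t ∈ Set.Ioo 0 T, ∀ x : ℝ, DifferentiableAt ℝ (fun s => u s x) t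
  continuous_u : ContinuousOn (fun p : ℝ × ℝ => u p.1 p.2) (Set.Ioo 0 T ×ˢ Set.univ)
  continuous_ut :
    ContinuousOn (fun p : ℝ × ℝ => deriv (fun s => u s p.2) p.1) (Set.Ioo 0 T ×ˢ Set.univ)
  continuous_ux : ContinuousOn (fun p : ℝ × ℝ => deriv (u p.1) p.2) (Set.Ioo 0 T ×ˢ Set.univ)
  continuous_uxx :
    ContinuousOn (fun p : ℝ × ℝ => deriv (deriv (u p.1)) p.2) (Set.Ioo 0 T ×ˢ Set.univ)
  equation : ∀ t ∈ Set.Ioo 0 T, ∃ w : ℝ → ℝ, IsFracLaplacian α (u t) w ∧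
    ∀ x : ℝ, deriv (fun s => u s x) t + u t x * deriv (u t) x + ν * w x = 0

/-- The classical enstrophy `½ ∫₀¹ |f_x|² dx`. -/
def enstrophy (f : ℝ → ℝ) : ℝ := (1 / 2) * ∫ x in (0 : ℝ)..1, |deriv f x| ^ 2

/-- The exponent `γ₁`. -/
def gammaOne (α : ℝ) : ℝ := (6 * α - 1) / (4 * α - 1)

/-- The prefactor `σ₁`; the last branch is meant for `1/4 < α < 1/2`. -/
def sigmaOne (ν α : ℝ) : ℝ :=
  if 1 / 2 < α then
    (4 * α - 1) /
      ((2 * α - 1) * (2 : ℝ) ^ ((2 * α + 1) / (4 * α - 1)) * ν ^ (1 / (4 * α - 1)) *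
        Real.pi ^ (2 * α / (4 * α - 1)))
  else if α = 1 / 2 then
    1 / (2 * ν)
  else
    (4 * α - 1) /
      ((2 : ℝ) ^ ((8 * α + 1) / (4 * α - 1)) * Real.pi ^ (2 * α / (4 * α - 1)) *
        α ^ (4 * α / (4 * α - 1)) * ν ^ (1 / (4 * α - 1))) *
      (Real.Gamma ((1 - α) / 2) / Real.Gamma ((1 + α) / 2)) ^ (2 / (4 * α - 1))

end FracBurgers

end

/-! The enstrophy `E` is governed by the balance `dE/dt = -½ ∫ u_x³ + ν ∫ (-Δ)^α u · u_xx`. The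
difference of two enstrophies, integrated by parts, is `-½ ∫ (f - g)(f'' + g'')`
(`enstrophy_sub_enstrophy`), so that the derivative in time exists and equals `-∫ u_t u_xx` without
any mixed derivative `u_{xt}`; inserting the equation gives the balance.

Let `c_n`, for `n ≥ 0`, be the Fourier coefficients of `v = u_x`; thus `c_0 = 0`. With
`A = ∑ |c_n|²` and `D = ∑ n^{2α} |c_n|²`, Parseval gives `E = A` and the dissipation
`2ν(2π)^{2α} D`. For the cubic term, write `v = F + F̄` with `F = ∑ c_n e^{2πinx}`. As `F` has only
positive frequencies, `∫ F³ = 0` and `∫ v³ = 6 Re ∫ F² F̄`, whence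
`½ |∫ v³| ≤ 3 ∑_n |c_n| ∑_{i+j=n} |c_i| |c_j|` (`abs_integral_cube_le`).

The trilinear sum is estimated by Cauchy–Schwarz with the weight `(iᵇ + jᵇ)/2` on the pairs
`i + j = n` (`tsum_mul_sum_antidiagonal_le`): it is at most `√W A^{3/2-1/(4α)} D^{1/(4α)}`, where
`W` bounds the sums of `2/(iᵇ + jᵇ)` by `W n^{1-b}`. One takes `b = 0`, `W = 1` for `α ≥ 1/2`, and
`b = 1 - 2α`, `W = 2 - √2/3` for `α < 1/2`; the latter choice needs `b ≤ 2α`, that is `α ≥ 1/4`.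
Young's inequality then balances this against the dissipation and produces the exponent `gammaOne α`
(`mul_rpow_sub_mul_le_gammaOne`).

There remains the comparison of the resulting constant with `sigmaOne`. It is elementary for
`α ≥ 1/2`. For `α < 1/2` it amounts to `Γ((1-α)/2) / Γ((1+α)/2) ≥ (9W/2)^α`
(`rpow_le_Gamma_ratio`), which follows from the functional equation of `Γ`, used sixteen times,
and its log-convexity. -/

namespace FracBurgers

open Finset Filter
open scoped ComplexConjugate Topology

/-! ### Sums of the convolution weights -/

/-- `2 / y` lies below its chord on `[1, √2]`, by convexity. -/
theorem two_div_le_of_one_le_of_le_sqrt_two {y : ℝ} (h1 : 1 ≤ y) (h2 : y ≤ √2) :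
    2 / y ≤ 2 + √2 - √2 * y := by
  have hs : √2 * √2 = 2 := Real.mul_self_sqrt (by norm_num)
  rw [div_le_iff₀ (by linarith)]
  nlinarith [mul_nonneg (sub_nonneg.2 h1) (sub_nonneg.2 h2), Real.sqrt_nonneg 2]

/-- Comparison of `√1 + ⋯ + √n` with `∫₀ⁿ √x dx`. -/
theorem two_thirds_mul_le_sum_sqrt (n : ℕ) :
    2 / 3 * ((n : ℝ) * √n) ≤ ∑ i ∈ range n, √((i : ℝ) + 1) := by
  induction n with
  | zero => simp
  | succ n ih =>
    rw [sum_range_succ]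
    push_cast
    have h0 : (0 : ℝ) ≤ n := n.cast_nonneg
    have ha := Real.sqrt_nonneg (n : ℝ)
    have hb := Real.sqrt_nonneg ((n : ℝ) + 1)
    have ha2 := Real.sq_sqrt h0
    have hb2 := Real.sq_sqrt (by linarith : (0 : ℝ) ≤ n + 1)
    set a := √(n : ℝ)
    set b := √((n : ℝ) + 1)
    have hab : a ≤ b := Real.sqrt_le_sqrt (by linarith)
    have h1 : (n : ℝ) * a = a ^ 3 := by rw [← ha2]; ring
    have h2 : ((n : ℝ) + 1) * b = b ^ 3 := by rw [← hb2]; ring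
    rw [h2]
    rw [h1] at ih
    have h3 : b ^ 2 - a ^ 2 = 1 := by rw [ha2, hb2]; ring
    have h4 : b * (b ^ 2 - a ^ 2) = b := by rw [h3, mul_one]
    nlinarith [mul_nonneg (sq_nonneg (b - a)) (by linarith : 0 ≤ b + 2 * a)]

/-- For `b ≤ 1/2`, the reciprocals of the weights `(iᵇ + jᵇ)/2`, summed over `i + j = n` with
`i, j ≥ 1`, are at most `(2 - √2/3) n^{1-b}`; the indices are shifted by one and `n = k + 2`.
The value `2 - √2/3` is `∫₀¹ (2 + √2 - √2(√x + √(1-x))) dx`. -/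
theorem sum_two_div_rpow_add_rpow_le {b : ℝ} (hb : b ≤ 1 / 2) (k : ℕ) :
    ∑ p ∈ antidiagonal k, 2 / (((p.1 : ℝ) + 1) ^ b + ((p.2 : ℝ) + 1) ^ b) ≤
      (2 - √2 / 3) * ((k : ℝ) + 2) ^ (1 - b) := by
  set n : ℝ := (k : ℝ) + 2 with hn
  have hnpos : 0 < n := by positivity
  have hnb : 0 < n ^ b := Real.rpow_pos_of_pos hnpos b
  have hsn : 0 < √n := Real.sqrt_pos.2 hnpos
  have hs2 : √2 * √2 = 2 := Real.mul_self_sqrt (by norm_num)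
  have hs2' : √2 ≤ 2 := by nlinarith [Real.sqrt_nonneg 2]
  have key : ∀ p ∈ antidiagonal k, 2 / (((p.1 : ℝ) + 1) ^ b + ((p.2 : ℝ) + 1) ^ b) ≤
      (n ^ b)⁻¹ * (2 + √2 - √2 * (√((p.1 : ℝ) + 1) / √n + √((p.2 : ℝ) + 1) / √n)) := by
    intro p hp
    have hsum : ((p.1 : ℝ) + 1) + ((p.2 : ℝ) + 1) = n := by
      have : (p.1 : ℝ) + p.2 = k := by exact_mod_cast mem_antidiagonal.1 hp
      rw [hn]; linarith
    have hi : (0 : ℝ) < (p.1 : ℝ) + 1 := by positivity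
    have hj : (0 : ℝ) < (p.2 : ℝ) + 1 := by positivity
    set i : ℝ := (p.1 : ℝ) + 1
    set j : ℝ := (p.2 : ℝ) + 1
    have hx0 : ∀ x : ℝ, 0 < x → x ≤ n → √x / √n * n ^ b ≤ x ^ b := by
      intro x hx hxn
      rw [← Real.sqrt_div hx.le, Real.sqrt_eq_rpow]
      have hd : 0 < x / n := by positivity
      have : (x / n) ^ (1 / 2 : ℝ) ≤ (x / n) ^ b :=
        Real.rpow_le_rpow_of_exponent_ge hd ((div_le_one hnpos).2 hxn) hb
      calc (x / n) ^ (1 / 2 : ℝ) * n ^ b ≤ (x / n) ^ b * n ^ b := by gcongr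
        _ = x ^ b := by rw [← Real.mul_rpow hd.le hnpos.le, div_mul_cancel₀ _ hnpos.ne']
    -- Since `b ≤ 1/2`, `(i/n)ᵇ + (j/n)ᵇ` is at least `√(i/n) + √(j/n)`, which lies in `[1, √2]`.
    have hi' := hx0 i hi (by linarith)
    have hj' := hx0 j hj (by linarith)
    have e1 : (√i / √n) ^ 2 + (√j / √n) ^ 2 = 1 := by
      rw [div_pow, div_pow, Real.sq_sqrt hi.le, Real.sq_sqrt hj.le, Real.sq_sqrt hnpos.le,
        ← add_div, hsum, div_self hnpos.ne']
    have p1 : 0 < √i / √n := div_pos (Real.sqrt_pos.2 hi) hsn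
    have p2 : 0 < √j / √n := div_pos (Real.sqrt_pos.2 hj) hsn
    set x := √i / √n
    set y := √j / √n
    have hy1 : 1 ≤ x + y := by nlinarith [mul_pos p1 p2]
    have hy2 : x + y ≤ √2 := Real.le_sqrt_of_sq_le (by nlinarith [sq_nonneg (x - y)])
    calc 2 / (i ^ b + j ^ b) ≤ 2 / ((x + y) * n ^ b) := by
          apply div_le_div_of_nonneg_left (by norm_num) (by positivity)
          linarith
      _ = (n ^ b)⁻¹ * (2 / (x + y)) := by field_simp
      _ ≤ _ := by
          gcongr
          exact two_div_le_of_one_le_of_le_sqrt_two hy1 hy2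
  refine (sum_le_sum key).trans ?_
  rw [← mul_sum]
  have hswap : ∑ p ∈ antidiagonal k, √((p.2 : ℝ) + 1) / √n =
      ∑ p ∈ antidiagonal k, √((p.1 : ℝ) + 1) / √n :=
    Finset.Nat.sum_antidiagonal_swap (f := fun p : ℕ × ℕ => √((p.1 : ℝ) + 1) / √n)
  have hrange : ∑ p ∈ antidiagonal k, √((p.1 : ℝ) + 1) / √n =
      (∑ i ∈ range (k + 1), √((i : ℝ) + 1)) / √n := by
    rw [Finset.Nat.sum_antidiagonal_eq_sum_range_succ_mk, sum_div]
  -- The term `i = n` of the sum of square roots is absent here and costs the `- 1`.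
  have hlow : 2 / 3 * n - 1 ≤ (∑ i ∈ range (k + 1), √((i : ℝ) + 1)) / √n := by
    rw [le_div_iff₀ hsn]
    have := two_thirds_mul_le_sum_sqrt (k + 2)
    rw [sum_range_succ] at this
    push_cast at this
    rw [show (k : ℝ) + 1 + 1 = n by rw [hn]; ring, ← hn] at this
    linarith
  rw [sum_sub_distrib, ← mul_sum, sum_const, sum_add_distrib, hswap, hrange, Nat.card_antidiagonal,
    nsmul_eq_mul, Real.rpow_sub hnpos, Real.rpow_one]
  rw [show (2 - √2 / 3) * (n / n ^ b) = (n ^ b)⁻¹ * ((2 - √2 / 3) * n) by field_simp]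
  gcongr
  push_cast
  rw [show (k : ℝ) + 1 = n - 1 by rw [hn]; ring]
  nlinarith [mul_le_mul_of_nonneg_left hlow (Real.sqrt_nonneg 2)]

/-! ### The trilinear estimate for sequences -/

/-- Cauchy–Schwarz for the convolution square of `c`, with weight `(iᵇ + jᵇ)/2`. The terms with
`i = 0` or `j = 0` vanish because `c 0 = 0`. -/
theorem sq_sum_antidiagonal_le {W b : ℝ}
    (hW : ∀ k : ℕ, ∑ p ∈ antidiagonal k, 2 / (((p.1 : ℝ) + 1) ^ b + ((p.2 : ℝ) + 1) ^ b) ≤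
      W * ((k : ℝ) + 2) ^ (1 - b)) {c : ℕ → ℝ} (hc : c 0 = 0) (n : ℕ) :
    (∑ p ∈ antidiagonal n, c p.1 * c p.2) ^ 2 ≤ W * (n : ℝ) ^ (1 - b) *
      ∑ p ∈ antidiagonal n, ((p.1 : ℝ) ^ b + (p.2 : ℝ) ^ b) / 2 * (c p.1 ^ 2 * c p.2 ^ 2) := by
  rcases n with _ | _ | k
  · simp [hc]
  · simp [hc, Finset.Nat.sum_antidiagonal_succ]
  · rw [Finset.Nat.sum_antidiagonal_succ, Finset.Nat.sum_antidiagonal_succ',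
      Finset.Nat.sum_antidiagonal_succ (n := k + 1), Finset.Nat.sum_antidiagonal_succ' (n := k)]
    simp only [hc, zero_mul, mul_zero, zero_add, ne_eq, OfNat.ofNat_ne_zero,
      not_false_eq_true, zero_pow]
    refine (sum_sq_le_sum_mul_sum_of_sq_le_mul _
      (f := fun p : ℕ × ℕ => 2 / (((p.1 : ℝ) + 1) ^ b + ((p.2 : ℝ) + 1) ^ b))
      (g := fun p : ℕ × ℕ => (((p.1 + 1 : ℕ) : ℝ) ^ b + ((p.2 + 1 : ℕ) : ℝ) ^ b) / 2 *
        (c (p.1 + 1) ^ 2 * c (p.2 + 1) ^ 2)) (fun p _ => by positivity)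
      (fun p _ => by positivity) (fun p _ => ?_)).trans ?_
    · have h1 : 0 < ((p.1 : ℝ) + 1) ^ b := Real.rpow_pos_of_pos (by positivity) _
      have h2 : 0 < ((p.2 : ℝ) + 1) ^ b := Real.rpow_pos_of_pos (by positivity) _
      refine le_of_eq ?_
      push_cast
      field_simp
    · refine mul_le_mul_of_nonneg_right ?_ (sum_nonneg fun p _ => by positivity)
      refine (hW k).trans (le_of_eq ?_)
      push_cast
      ring_nf

/-- Interpolation between `∑ c²` and `∑ nˢ c²`. The assumption `c 0 = 0` only serves to make both
sums vanish together. -/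
theorem summable_and_tsum_rpow_mul_sq_le {c : ℕ → ℝ} (hc : c 0 = 0) {s θ : ℝ} (hs : 0 ≤ s)
    (h0 : 0 ≤ θ) (h1 : θ ≤ 1) (hA : Summable fun n => c n ^ 2)
    (hD : Summable fun n : ℕ => (n : ℝ) ^ s * c n ^ 2) :
    (Summable fun n : ℕ => (n : ℝ) ^ (s * θ) * c n ^ 2) ∧
      ∑' n : ℕ, (n : ℝ) ^ (s * θ) * c n ^ 2 ≤
        (∑' n, c n ^ 2) ^ (1 - θ) * (∑' n : ℕ, (n : ℝ) ^ s * c n ^ 2) ^ θ := by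
  set A := ∑' n, c n ^ 2 with hAdef
  set D := ∑' n : ℕ, (n : ℝ) ^ s * c n ^ 2 with hDdef
  have hA0 : 0 ≤ A := tsum_nonneg fun n => sq_nonneg _
  have hAD : A ≤ D := by
    refine hA.tsum_le_tsum (fun n => ?_) hD
    rcases Nat.eq_zero_or_pos n with rfl | hn
    · simp [hc]
    · have : (1 : ℝ) ≤ (n : ℝ) ^ s := Real.one_le_rpow (by exact_mod_cast hn) hs
      nlinarith [sq_nonneg (c n)]
  rcases hA0.eq_or_lt with hA00 | hApos
  · have hz : ∀ n, c n ^ 2 = 0 := by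
      have := (hasSum_zero_iff_of_nonneg (fun n => sq_nonneg (c n))).1
        (by rw [hA00]; exact hA.hasSum)
      exact fun n => congrFun this n
    simp only [hz, mul_zero]
    refine ⟨summable_zero, ?_⟩
    rw [tsum_zero]
    exact mul_nonneg (Real.rpow_nonneg hA0 _) (Real.rpow_nonneg (hA0.trans hAD) _)
  have hDpos : 0 < D := hApos.trans_le hAD
  -- Weighted AM–GM applied to each term, normalized by the two sums.
  have key : ∀ n : ℕ, (n : ℝ) ^ (s * θ) * c n ^ 2 ≤
      A ^ (1 - θ) * D ^ θ * ((1 - θ) * (c n ^ 2 / A) + θ * ((n : ℝ) ^ s * c n ^ 2 / D)) := by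
    intro n
    have hns : (0 : ℝ) ≤ (n : ℝ) ^ s := by positivity
    by_cases hcn : c n = 0
    · simp [hcn]
    have hcn2 : 0 < c n ^ 2 := by positivity
    have hw := Real.geom_mean_le_arith_mean2_weighted (sub_nonneg.2 h1) h0
      (p₁ := c n ^ 2 / A) (p₂ := (n : ℝ) ^ s * c n ^ 2 / D) (by positivity) (by positivity)
      (by ring)
    have hAp : 0 < A ^ (1 - θ) := Real.rpow_pos_of_pos hApos _
    have hDp : 0 < D ^ θ := Real.rpow_pos_of_pos hDpos _
    calc (n : ℝ) ^ (s * θ) * c n ^ 2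
        = A ^ (1 - θ) * D ^ θ * ((c n ^ 2 / A) ^ (1 - θ) * ((n : ℝ) ^ s * c n ^ 2 / D) ^ θ) := by
          rw [Real.div_rpow hcn2.le hA0, Real.div_rpow (by positivity) hDpos.le,
            Real.mul_rpow hns hcn2.le, ← Real.rpow_mul (by positivity)]
          have : c n ^ 2 = (c n ^ 2) ^ (1 - θ) * (c n ^ 2) ^ θ := by
            rw [← Real.rpow_add hcn2]; simp
          field_simp
          rw [mul_assoc, ← this]
      _ ≤ _ := by gcongr
  have hsum : HasSum (fun n : ℕ => A ^ (1 - θ) * D ^ θ *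
      ((1 - θ) * (c n ^ 2 / A) + θ * ((n : ℝ) ^ s * c n ^ 2 / D))) (A ^ (1 - θ) * D ^ θ) := by
    have := (((hA.hasSum.div_const A).mul_left (1 - θ)).add
      ((hD.hasSum.div_const D).mul_left θ)).mul_left (A ^ (1 - θ) * D ^ θ)
    convert! this using 1
    rw [← hAdef, ← hDdef, div_self hApos.ne', div_self hDpos.ne']
    ring
  have hsm : Summable fun n : ℕ => (n : ℝ) ^ (s * θ) * c n ^ 2 :=
    hsum.summable.of_nonneg_of_le (fun n => by positivity) key
  exact ⟨hsm, hsum.tsum_eq ▸ hsm.tsum_le_tsum key hsum.summable⟩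

/-- The trilinear estimate for a nonnegative sequence. Cauchy–Schwarz in the weighted convolution
and then in `n` bounds the square of the left side by
`W (∑ n^{1-b} c²) (∑ nᵇ c²) (∑ c²)`, and the first two sums interpolate. -/
theorem tsum_mul_sum_antidiagonal_le {W b s : ℝ} (hW0 : 0 ≤ W)
    (hW : ∀ k : ℕ, ∑ p ∈ antidiagonal k, 2 / (((p.1 : ℝ) + 1) ^ b + ((p.2 : ℝ) + 1) ^ b) ≤
      W * ((k : ℝ) + 2) ^ (1 - b)) (hs : 0 < s) (hb0 : 0 ≤ b) (hb1 : b ≤ 1) (hbs : b ≤ s)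
    (hbs' : 1 - b ≤ s) {c : ℕ → ℝ} (hc : c 0 = 0) (hc0 : ∀ n, 0 ≤ c n)
    (hA : Summable fun n => c n ^ 2) (hD : Summable fun n : ℕ => (n : ℝ) ^ s * c n ^ 2) :
    ∑' n, c n * ∑ p ∈ antidiagonal n, c p.1 * c p.2 ≤
      √W * ((∑' n, c n ^ 2) ^ (3 / 2 - 1 / (2 * s)) *
        (∑' n : ℕ, (n : ℝ) ^ s * c n ^ 2) ^ (1 / (2 * s))) := by
  obtain ⟨hYs, hY⟩ := summable_and_tsum_rpow_mul_sq_le hc hs.le (θ := b / s) (by positivity)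
    ((div_le_one hs).2 hbs) hA hD
  obtain ⟨hXs, hX⟩ := summable_and_tsum_rpow_mul_sq_le hc hs.le (θ := (1 - b) / s)
    (div_nonneg (by linarith) hs.le) ((div_le_one hs).2 hbs') hA hD
  rw [mul_div_cancel₀ _ hs.ne'] at hX hXs hY hYs
  have hA0 : 0 ≤ ∑' n, c n ^ 2 := tsum_nonneg fun n => sq_nonneg _
  have hD0 : 0 ≤ ∑' n : ℕ, (n : ℝ) ^ s * c n ^ 2 := tsum_nonneg fun n => by positivity
  have hX0 : 0 ≤ ∑' n : ℕ, (n : ℝ) ^ (1 - b) * c n ^ 2 := tsum_nonneg fun n => by positivity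
  have hY0 : 0 ≤ ∑' n : ℕ, (n : ℝ) ^ b * c n ^ 2 := tsum_nonneg fun n => by positivity
  set Q : ℕ → ℝ := fun n =>
    ∑ p ∈ antidiagonal n, ((p.1 : ℝ) ^ b + (p.2 : ℝ) ^ b) / 2 * (c p.1 ^ 2 * c p.2 ^ 2) with hQ
  have hQ0 : ∀ n, 0 ≤ Q n := fun n => sum_nonneg fun p _ => by positivity
  -- Summed over all `n`, the weighted convolution factorizes.
  have hQsum : HasSum Q ((∑' n : ℕ, (n : ℝ) ^ b * c n ^ 2) * ∑' n, c n ^ 2) := by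
    have n1 := hYs.norm
    have n2 := hA.norm
    have s1 := (summable_norm_sum_mul_antidiagonal_of_summable_norm n1 n2).of_norm.hasSum
    rw [← tsum_mul_tsum_eq_tsum_sum_antidiagonal_of_summable_norm n1 n2] at s1
    have s2 := (summable_norm_sum_mul_antidiagonal_of_summable_norm n2 n1).of_norm.hasSum
    rw [← tsum_mul_tsum_eq_tsum_sum_antidiagonal_of_summable_norm n2 n1] at s2
    convert! (s1.add s2).mul_left (1 / 2) using 1
    · ext n
      rw [← sum_add_distrib, mul_sum]
      exact sum_congr rfl fun p _ => by ring
    · ring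
  set A := ∑' n, c n ^ 2
  set D := ∑' n : ℕ, (n : ℝ) ^ s * c n ^ 2
  set X := ∑' n : ℕ, (n : ℝ) ^ (1 - b) * c n ^ 2
  set Y := ∑' n : ℕ, (n : ℝ) ^ b * c n ^ 2
  -- The exponents of `D` are `(1-b)/s` and `b/s`, with sum `1/s` whatever `b` is.
  have hXYA : X * (Y * A) ≤ (A ^ (3 / 2 - 1 / (2 * s)) * D ^ (1 / (2 * s))) ^ 2 := by
    rcases hA0.eq_or_lt with h | hApos
    · rw [← h]; simp only [mul_zero]; positivity
    rcases hD0.eq_or_lt with h | hDpos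
    · have hD' : ∀ n : ℕ, (n : ℝ) ^ s * c n ^ 2 = 0 := by
        have := (hasSum_zero_iff_of_nonneg
          (fun n : ℕ => (by positivity : 0 ≤ (n : ℝ) ^ s * c n ^ 2))).1
          (by rw [h]; exact hD.hasSum)
        exact fun n => congrFun this n
      have : A = 0 := by
        refine (tsum_congr fun n => ?_).trans tsum_zero
        rcases Nat.eq_zero_or_pos n with rfl | hn
        · simp [hc]
        · have h3 : (0 : ℝ) < (n : ℝ) ^ s := Real.rpow_pos_of_pos (by exact_mod_cast hn) _
          exact (mul_eq_zero.1 (hD' n)).resolve_left h3.ne'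
      exact absurd this hApos.ne'
    calc X * (Y * A) ≤ (A ^ (1 - (1 - b) / s) * D ^ ((1 - b) / s)) *
          ((A ^ (1 - b / s) * D ^ (b / s)) * A) := by gcongr
      _ = (A ^ (1 - (1 - b) / s) * A ^ (1 - b / s) * A ^ (1 : ℝ)) *
          (D ^ ((1 - b) / s) * D ^ (b / s)) := by rw [Real.rpow_one]; ring
      _ = A ^ ((3 / 2 - 1 / (2 * s)) * 2) * D ^ (1 / (2 * s) * 2) := by
          rw [← Real.rpow_add hApos, ← Real.rpow_add hApos, ← Real.rpow_add hDpos]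
          congr 2 <;> · field_simp; ring
      _ = _ := by
          rw [Real.rpow_mul hA0, Real.rpow_mul hD0, mul_pow, Real.rpow_two, Real.rpow_two]
  refine Real.tsum_le_of_sum_range_le
    (fun n => mul_nonneg (hc0 n) (sum_nonneg fun p _ => mul_nonneg (hc0 _) (hc0 _))) fun N => ?_
  refine le_of_sq_le_sq (a := _) ?_ (by positivity)
  calc (∑ n ∈ range N, c n * ∑ p ∈ antidiagonal n, c p.1 * c p.2) ^ 2
      ≤ (∑ n ∈ range N, W * ((n : ℝ) ^ (1 - b) * c n ^ 2)) * ∑ n ∈ range N, Q n := by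
        refine sum_sq_le_sum_mul_sum_of_sq_le_mul _ (fun n _ => by positivity)
          (fun n _ => hQ0 n) fun n _ => ?_
        rw [mul_pow]
        calc c n ^ 2 * (∑ p ∈ antidiagonal n, c p.1 * c p.2) ^ 2
            ≤ c n ^ 2 * (W * (n : ℝ) ^ (1 - b) * Q n) := by
              gcongr
              exact sq_sum_antidiagonal_le hW hc n
          _ = _ := by ring
    _ ≤ (W * X) * (Y * A) := by
        gcongr
        · rw [← mul_sum]
          gcongr
          exact hXs.sum_le_tsum _ fun n _ => by positivity
        · exact sum_le_hasSum _ (fun n _ => hQ0 n) hQsum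
    _ ≤ _ := by
        rw [mul_pow, Real.sq_sqrt hW0, mul_assoc]
        exact mul_le_mul_of_nonneg_left hXYA hW0

/-! ### A lower bound for the Gamma ratio -/

/-- The first term of the series of `log ((1 + x) / (1 - x))` at `x = a / m`. -/
theorem exp_two_mul_div_le {m a : ℝ} (ha : 0 ≤ a) (ham : a < m) :
    Real.exp (2 * a / m) ≤ (m + a) / (m - a) := by
  have hm : 0 < m := ha.trans_lt ham
  have hx : |a / m| < 1 := by
    rw [abs_of_nonneg (by positivity), div_lt_one hm]; exact ham
  have h := Real.hasSum_log_sub_log_of_abs_lt_one hx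
  have h0 : 2 * (a / m) ≤ Real.log (1 + a / m) - Real.log (1 - a / m) := by
    have := le_hasSum h 0 fun k _ => by positivity
    simpa using this
  have h1 : 0 < 1 + a / m := by positivity
  have h2 : 0 < 1 - a / m := by linarith [(abs_lt.1 hx).2]
  rw [← Real.log_div h1.ne' h2.ne', Real.le_log_iff_exp_le (by positivity)] at h0
  have h3 : 0 < m - a := by linarith
  calc Real.exp (2 * a / m) = Real.exp (2 * (a / m)) := by rw [mul_div_assoc]
    _ ≤ _ := h0
    _ = _ := by rw [div_eq_div_iff h2.ne' h3.ne']; field_simp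

/-- Lower bound for the Gamma ratio by its value after `N` shifts of both arguments: each shift
contributes a factor `(2k+1+a)/(2k+1-a) ≥ e^{2a/(2k+1)}`. -/
theorem exp_sum_mul_Gamma_le {a : ℝ} (ha0 : 0 < a) (ha1 : a < 1) (N : ℕ) :
    Real.exp (a * ∑ k ∈ range N, 2 / (2 * (k : ℝ) + 1)) *
        (Real.Gamma ((1 - a) / 2 + N) * Real.Gamma ((1 + a) / 2)) ≤
      Real.Gamma ((1 - a) / 2) * Real.Gamma ((1 + a) / 2 + N) := by
  induction N with
  | zero => simp
  | succ N ih =>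
    have hx : 0 < (1 - a) / 2 + N := by have : (0 : ℝ) ≤ N := N.cast_nonneg; linarith
    have hy : 0 < (1 + a) / 2 + N := by have : (0 : ℝ) ≤ N := N.cast_nonneg; linarith
    push_cast
    rw [sum_range_succ, mul_add, Real.exp_add, ← add_assoc, ← add_assoc,
      Real.Gamma_add_one hx.ne', Real.Gamma_add_one hy.ne']
    have hN : (0 : ℝ) ≤ N := N.cast_nonneg
    have hstep := exp_two_mul_div_le (m := 2 * N + 1) ha0.le (by linarith)
    have hr : (2 * N + 1 + a) / (2 * N + 1 - a) = ((1 + a) / 2 + N) / ((1 - a) / 2 + N) := by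
      rw [div_eq_div_iff (by linarith) hx.ne']; ring
    rw [hr, le_div_iff₀ hx, mul_div_assoc, mul_div_left_comm] at hstep
    have g1 := Real.Gamma_pos_of_pos hx
    have g2 : 0 < Real.Gamma ((1 + a) / 2) := Real.Gamma_pos_of_pos (by linarith)
    calc _ = (Real.exp (a * ∑ k ∈ range N, 2 / (2 * (k : ℝ) + 1)) *
          (Real.Gamma ((1 - a) / 2 + N) * Real.Gamma ((1 + a) / 2))) *
          (Real.exp (a * (2 / (2 * N + 1))) * ((1 - a) / 2 + N)) := by ring
      _ ≤ (Real.Gamma ((1 - a) / 2) * Real.Gamma ((1 + a) / 2 + N)) * ((1 + a) / 2 + N) := by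
          gcongr
      _ = _ := by ring

/-- Log-convexity of `Γ` between `x` and `x + 1`. -/
theorem Gamma_add_le_rpow_mul_Gamma {x a : ℝ} (hx : 0 < x) (ha0 : 0 < a) (ha1 : a < 1) :
    Real.Gamma (x + a) ≤ x ^ a * Real.Gamma x := by
  have h := Real.Gamma_mul_add_mul_le_rpow_Gamma_mul_rpow_Gamma hx (by linarith : 0 < x + 1)
    (by linarith : 0 < 1 - a) ha0 (by ring)
  have hg := Real.Gamma_pos_of_pos hx
  rw [Real.Gamma_add_one hx.ne', Real.mul_rpow hx.le hg.le] at h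
  calc Real.Gamma (x + a) = Real.Gamma ((1 - a) * x + a * (x + 1)) := by ring_nf
    _ ≤ _ := h
    _ = x ^ a * (Real.Gamma x ^ (1 - a) * Real.Gamma x ^ a) := by ring
    _ = _ := by rw [← Real.rpow_add hg]; simp

theorem rpow_le_Gamma_div_Gamma {a c : ℝ} (ha0 : 0 < a) (ha1 : a < 1) (N : ℕ) (hc : 0 ≤ c)
    (hcN : c * (N + (1 - a) / 2) ≤ Real.exp (∑ k ∈ range N, 2 / (2 * (k : ℝ) + 1))) :
    c ^ a ≤ Real.Gamma ((1 - a) / 2) / Real.Gamma ((1 + a) / 2) := by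
  have hN : (0 : ℝ) ≤ N := N.cast_nonneg
  have hx : 0 < (1 - a) / 2 + N := by linarith
  have g1 := Real.Gamma_pos_of_pos hx
  have g2 : 0 < Real.Gamma ((1 + a) / 2) := Real.Gamma_pos_of_pos (by linarith)
  have g3 : 0 < Real.Gamma ((1 - a) / 2) := Real.Gamma_pos_of_pos (by linarith)
  have h1 := exp_sum_mul_Gamma_le ha0 ha1 N
  have h2 := Gamma_add_le_rpow_mul_Gamma hx ha0 ha1
  rw [show (1 - a) / 2 + N + a = (1 + a) / 2 + N by ring] at h2
  have h3 := Real.rpow_le_rpow (by positivity) hcN ha0.le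
  rw [← Real.exp_mul, mul_comm _ a, add_comm, Real.mul_rpow hc hx.le] at h3
  have hxa : 0 < ((1 - a) / 2 + N) ^ a := Real.rpow_pos_of_pos hx _
  rw [le_div_iff₀ g2]
  refine le_of_mul_le_mul_right ?_ (mul_pos hxa g1)
  calc c ^ a * Real.Gamma ((1 + a) / 2) * (((1 - a) / 2 + N) ^ a * Real.Gamma ((1 - a) / 2 + N))
      = c ^ a * ((1 - a) / 2 + N) ^ a *
        (Real.Gamma ((1 - a) / 2 + N) * Real.Gamma ((1 + a) / 2)) := by ring
    _ ≤ Real.exp (a * ∑ k ∈ range N, 2 / (2 * (k : ℝ) + 1)) *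
        (Real.Gamma ((1 - a) / 2 + N) * Real.Gamma ((1 + a) / 2)) := by gcongr
    _ ≤ _ := h1
    _ ≤ _ := by gcongr

/-- The Gamma ratio dominates `c ^ a` with `c = 9/2 (2 - √2/3) ≈ 6.879`. The largest admissible base
for all small `a` is `e^{-ψ(1/2)} = 4 e^γ ≈ 7.12`, so finitely many shifts suffice. -/
theorem rpow_le_Gamma_ratio {a : ℝ} (ha0 : 1 / 4 ≤ a) (ha1 : a < 1) :
    (9 / 2 * (2 - √2 / 3)) ^ a ≤ Real.Gamma ((1 - a) / 2) / Real.Gamma ((1 + a) / 2) := by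
  have hs : 1.414 ≤ √2 := Real.le_sqrt_of_sq_le (by norm_num)
  have hs2 : √2 ≤ 2 := Real.sqrt_le_iff.2 (by norm_num)
  -- Sixteen shifts are enough: `∑_{k<16} 2/(2k+1) ≈ 4.7363` and `log (6.88 · 16.375) ≈ 4.7244`.
  refine rpow_le_Gamma_div_Gamma (by linarith) ha1 16 (by linarith) ?_
  have he : (2.7182818283 : ℝ) ^ 4 ≤ Real.exp 4 := by
    have := Real.exp_one_gt_d9
    calc (2.7182818283 : ℝ) ^ 4 ≤ Real.exp 1 ^ 4 := by gcongr
      _ = Real.exp 4 := by rw [← Real.exp_nat_mul]; norm_num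
  have hq := Real.quadratic_le_exp_of_nonneg (by norm_num : (0 : ℝ) ≤ 0.184)
  have hq2 : (1.2009 : ℝ) ^ 4 ≤ Real.exp 0.736 := by
    calc (1.2009 : ℝ) ^ 4 ≤ Real.exp 0.184 ^ 4 := by gcongr; norm_num at hq ⊢; linarith
      _ = Real.exp 0.736 := by rw [← Real.exp_nat_mul]; norm_num
  calc 9 / 2 * (2 - √2 / 3) * ((16 : ℕ) + (1 - a) / 2) ≤ 6.88 * 16.375 := by
        push_cast
        gcongr <;> linarith
    _ ≤ (2.7182818283 : ℝ) ^ 4 * 1.2009 ^ 4 := by norm_num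
    _ ≤ Real.exp 4 * Real.exp 0.736 := by gcongr
    _ = Real.exp 4.736 := by rw [← Real.exp_add]; norm_num
    _ ≤ _ := by
        apply Real.exp_le_exp.2
        norm_num [sum_range_succ]

/-! ### Young's inequality and the prefactor -/

/-- Young's inequality, in the form that absorbs a fractional power of `D` into `κ D`. -/
theorem mul_rpow_sub_mul_le {M κ p q A D : ℝ} (hM : 0 < M) (hκ : 0 < κ) (hp0 : 0 < p) (hp1 : p < 1)
    (hA : 0 ≤ A) (hD : 0 ≤ D) :
    M * (A ^ q * D ^ p) - κ * D ≤
      (1 - p) * ((M * (p / κ) ^ p) ^ (1 / (1 - p)) * A ^ (q / (1 - p))) := by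
  have hp : 0 < 1 - p := by linarith
  have hB : 0 ≤ M * (p / κ) ^ p * A ^ q := by positivity
  have h := Real.geom_mean_le_arith_mean2_weighted hp0.le hp.le
    (p₁ := κ * D / p) (p₂ := (M * (p / κ) ^ p * A ^ q) ^ (1 / (1 - p)))
    (by positivity) (by positivity) (by ring)
  rw [← Real.rpow_mul hB, one_div_mul_cancel hp.ne', Real.rpow_one,
    mul_div_cancel₀ _ hp0.ne', Real.mul_rpow (by positivity) (by positivity),
    ← Real.rpow_mul hA, mul_one_div] at h
  have e : (κ * D / p) ^ p * (M * (p / κ) ^ p * A ^ q) = M * (A ^ q * D ^ p) := by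
    have e1 : (κ * D / p) ^ p * (p / κ) ^ p = D ^ p := by
      rw [← Real.mul_rpow (by positivity) (by positivity)]
      congr 1
      field_simp
    calc _ = M * (A ^ q * ((κ * D / p) ^ p * (p / κ) ^ p)) := by ring
      _ = _ := by rw [e1]
  rw [e] at h
  linarith

/-- Young's inequality at the exponent `p = 1/(4α)`, which is below `1` exactly when `α > 1/4`; the
remaining power of `A` is then `gammaOne α`. -/
theorem mul_rpow_sub_mul_le_gammaOne {M κ α A D : ℝ} (hM : 0 < M) (hκ : 0 < κ) (hα : 1 / 4 < α)
    (hA : 0 ≤ A) (hD : 0 ≤ D) :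
    M * (A ^ (3 / 2 - 1 / (4 * α)) * D ^ (1 / (4 * α))) - κ * D ≤
      (4 * α - 1) * ((M / (4 * α)) ^ (4 * α) / κ) ^ (1 / (4 * α - 1)) * A ^ gammaOne α := by
  have hα0 : 0 < α := by linarith
  have hm : 0 < 4 * α - 1 := by linarith
  have h4 : 0 < 4 * α := by linarith
  have h := mul_rpow_sub_mul_le (p := 1 / (4 * α)) (q := 3 / 2 - 1 / (4 * α)) hM hκ (by positivity)
    ((div_lt_one h4).2 (by linarith)) hA hD
  have e1 : 1 - 1 / (4 * α) = (4 * α - 1) / (4 * α) := by field_simp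
  have e2 : (3 / 2 - 1 / (4 * α)) / ((4 * α - 1) / (4 * α)) = gammaOne α := by
    unfold gammaOne
    field_simp
    ring
  have e3 : 1 / ((4 * α - 1) / (4 * α)) = 4 * α * (1 / (4 * α - 1)) := by field_simp
  have e4 : (M * (1 / (4 * α) / κ) ^ (1 / (4 * α))) ^ (4 * α * (1 / (4 * α - 1))) =
      (M ^ (4 * α) * (1 / (4 * α) / κ)) ^ (1 / (4 * α - 1)) := by
    rw [Real.rpow_mul (by positivity), Real.mul_rpow hM.le (by positivity),
      ← Real.rpow_mul (by positivity), one_div_mul_cancel h4.ne', Real.rpow_one]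
  have e5 : (M ^ (4 * α) * (1 / (4 * α) / κ)) ^ (1 / (4 * α - 1)) =
      4 * α * ((M / (4 * α)) ^ (4 * α) / κ) ^ (1 / (4 * α - 1)) := by
    have e6 : M ^ (4 * α) * (1 / (4 * α) / κ) =
        (4 * α) ^ (4 * α - 1) * ((M / (4 * α)) ^ (4 * α) / κ) := by
      rw [Real.div_rpow hM.le h4.le, Real.rpow_sub h4, Real.rpow_one]
      field_simp
    rw [e6, Real.mul_rpow (by positivity) (by positivity), ← Real.rpow_mul h4.le,
      mul_one_div_cancel hm.ne', Real.rpow_one]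
  rw [e1, e2, e3, e4, e5] at h
  refine h.trans (le_of_eq ?_)
  field_simp

/-- The factor of `∑ n^{2α}|c_n|²` in the dissipation, in the form in which it enters `sigmaOne`. -/
theorem two_mul_mul_two_pi_rpow {ν α : ℝ} :
    2 * ν * (2 * Real.pi) ^ (2 * α) = (2 : ℝ) ^ (2 * α + 1) * ν * Real.pi ^ (2 * α) := by
  rw [Real.mul_rpow (by norm_num) Real.pi_pos.le, Real.rpow_add (by norm_num), Real.rpow_one]
  ring

/-- For `α > 1/2` the comparison with `sigmaOne` reduces to `(3/(4α))^{4α} (2α-1)^{4α-1} ≤ 1`. -/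
theorem coeff_le_sigmaOne_of_half_lt {ν α : ℝ} (hν : 0 < ν) (hα : 1 / 2 < α) (hα1 : α ≤ 1) :
    (4 * α - 1) * ((3 / (4 * α)) ^ (4 * α) / (2 * ν * (2 * Real.pi) ^ (2 * α))) ^
      (1 / (4 * α - 1)) ≤ sigmaOne ν α := by
  have hm : 0 < 4 * α - 1 := by linarith
  have hy : 0 < 2 * α - 1 := by linarith
  have hπ := Real.pi_pos
  have hσ : sigmaOne ν α = (4 * α - 1) *
      (1 / ((2 * α - 1) ^ (4 * α - 1) * ((2 : ℝ) ^ (2 * α + 1) * ν * Real.pi ^ (2 * α)))) ^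
        (1 / (4 * α - 1)) := by
    rw [sigmaOne, if_pos hα, Real.div_rpow (by norm_num) (by positivity), Real.one_rpow,
      Real.mul_rpow (by positivity) (by positivity), Real.mul_rpow (by positivity) (by positivity),
      Real.mul_rpow (by positivity) (by positivity), ← Real.rpow_mul hy.le,
      ← Real.rpow_mul (by norm_num), ← Real.rpow_mul hπ.le, mul_one_div_cancel hm.ne',
      Real.rpow_one, mul_one_div, mul_one_div, mul_one_div]
    congr 1
    ring
  rw [hσ, two_mul_mul_two_pi_rpow]
  have hκ : 0 < (2 : ℝ) ^ (2 * α + 1) * ν * Real.pi ^ (2 * α) := by positivity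
  generalize (2 : ℝ) ^ (2 * α + 1) * ν * Real.pi ^ (2 * α) = κ at hκ ⊢
  rw [← div_div 1]
  gcongr
  rw [le_div_iff₀ (by positivity)]
  have h1 : (2 * α - 1) ^ (4 * α - 1) ≤ (2 * α - 1) ^ (2 * α) :=
    Real.rpow_le_rpow_of_exponent_ge hy (by linarith) (by linarith)
  have h2 : (3 / (4 * α)) ^ (4 * α) = ((3 / (4 * α)) ^ 2) ^ (2 * α) := by
    rw [← Real.rpow_two, ← Real.rpow_mul (by positivity)]
    ring_nf
  calc (3 / (4 * α)) ^ (4 * α) * (2 * α - 1) ^ (4 * α - 1)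
      ≤ ((3 / (4 * α)) ^ 2) ^ (2 * α) * (2 * α - 1) ^ (2 * α) := by rw [h2]; gcongr
    _ = ((3 / (4 * α)) ^ 2 * (2 * α - 1)) ^ (2 * α) := by
        rw [Real.mul_rpow (by positivity) hy.le]
    _ ≤ 1 := by
        apply Real.rpow_le_one (by positivity) _ (by linarith)
        rw [div_pow, div_mul_eq_mul_div, div_le_one (by positivity)]
        nlinarith [sq_nonneg (α - 1)]

theorem coeff_le_sigmaOne_half {ν : ℝ} (hν : 0 < ν) :
    (4 * (1 / 2 : ℝ) - 1) * ((3 / (4 * (1 / 2 : ℝ))) ^ (4 * (1 / 2 : ℝ)) /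
      (2 * ν * (2 * Real.pi) ^ (2 * (1 / 2 : ℝ)))) ^ (1 / (4 * (1 / 2 : ℝ) - 1)) ≤
      sigmaOne ν (1 / 2) := by
  have hπ := Real.pi_gt_three
  rw [sigmaOne, if_neg (lt_irrefl _), if_pos rfl]
  norm_num
  rw [div_le_iff₀ (by positivity)]
  field_simp
  nlinarith

/-- For `α < 1/2` the comparison with `sigmaOne` reduces to the lower bound
`rpow_le_Gamma_ratio`. -/
theorem coeff_le_sigmaOne_of_lt_half {ν α : ℝ} (hν : 0 < ν) (hα : 1 / 4 < α) (hα1 : α < 1 / 2) :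
    (4 * α - 1) * ((3 * √(2 - √2 / 3) / (4 * α)) ^ (4 * α) /
      (2 * ν * (2 * Real.pi) ^ (2 * α))) ^ (1 / (4 * α - 1)) ≤ sigmaOne ν α := by
  have hm : 0 < 4 * α - 1 := by linarith
  have hα0 : 0 < α := by linarith
  have hπ := Real.pi_pos
  have hs2 : √2 ≤ 2 := Real.sqrt_le_iff.2 (by norm_num)
  have hW : 0 < 2 - √2 / 3 := by linarith
  obtain ⟨G, hG⟩ : ∃ G, G = Real.Gamma ((1 - α) / 2) / Real.Gamma ((1 + α) / 2) := ⟨_, rfl⟩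
  have hG0 : 0 < G := hG ▸ div_pos (Real.Gamma_pos_of_pos (by linarith))
    (Real.Gamma_pos_of_pos (by linarith))
  have hGW : (9 / 2 * (2 - √2 / 3)) ^ α ≤ G := hG ▸ rpow_le_Gamma_ratio hα.le (by linarith)
  have hσ : sigmaOne ν α = (4 * α - 1) *
      (G ^ 2 / ((2 : ℝ) ^ (8 * α + 1) * Real.pi ^ (2 * α) * α ^ (4 * α) * ν)) ^
        (1 / (4 * α - 1)) := by
    rw [sigmaOne, if_neg (by linarith), if_neg (by linarith), ← hG,
      Real.div_rpow (by positivity) (by positivity),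
      Real.mul_rpow (by positivity) (by positivity), Real.mul_rpow (by positivity) (by positivity),
      Real.mul_rpow (by positivity) (by positivity), ← Real.rpow_mul hα0.le,
      ← Real.rpow_mul (by norm_num), ← Real.rpow_mul hπ.le, ← Real.rpow_two,
      ← Real.rpow_mul hG0.le, mul_one_div, mul_one_div, mul_one_div, mul_one_div]
    ring
  rw [hσ, two_mul_mul_two_pi_rpow]
  gcongr ?_ * ?_ ^ _
  have e1 : (3 * √(2 - √2 / 3) / (4 * α)) ^ (4 * α) =
      ((9 / 2 * (2 - √2 / 3)) ^ α) ^ 2 / ((2 : ℝ) ^ (6 * α) * α ^ (4 * α)) := by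
    have h1 : (3 * √(2 - √2 / 3) / (4 * α)) ^ (2 : ℝ) =
        (9 / 2 * (2 - √2 / 3)) / ((2 : ℝ) ^ (3 : ℝ) * α ^ (2 : ℝ)) := by
      rw [Real.rpow_two, Real.rpow_two, div_pow, mul_pow, Real.sq_sqrt hW.le,
        show (2 : ℝ) ^ (3 : ℝ) = 8 by norm_num]
      field_simp
      ring
    rw [show 4 * α = 2 * (2 * α) by ring, Real.rpow_mul (by positivity) 2 (2 * α),
      show 2 * (2 * α) = 4 * α by ring, h1, Real.div_rpow (by positivity) (by positivity),
      Real.mul_rpow (x := (2 : ℝ) ^ (3 : ℝ)) (by positivity) (by positivity),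
      ← Real.rpow_mul (by norm_num), ← Real.rpow_mul hα0.le, ← Real.rpow_two, ← Real.rpow_mul (by positivity)]
    ring_nf
  rw [e1, div_div]
  have e2 : (2 : ℝ) ^ (6 * α) * α ^ (4 * α) * ((2 : ℝ) ^ (2 * α + 1) * ν * Real.pi ^ (2 * α)) =
      (2 : ℝ) ^ (8 * α + 1) * Real.pi ^ (2 * α) * α ^ (4 * α) * ν := by
    rw [show 8 * α + 1 = 6 * α + (2 * α + 1) by ring, Real.rpow_add (by norm_num) (6 * α)]
    ring
  rw [e2]
  gcongr

/-- The purely numerical half of the enstrophy estimate: the trilinear bound for the nonlinear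
term, balanced against the dissipation, gives the growth rate with prefactor `sigmaOne`. -/
theorem three_mul_tsum_sub_le {ν α : ℝ} (hν : 0 < ν) (hα : 1 / 4 < α) (hα1 : α ≤ 1) {c : ℕ → ℝ}
    (hc : c 0 = 0) (hc0 : ∀ n, 0 ≤ c n) (hA : Summable fun n => c n ^ 2)
    (hD : Summable fun n : ℕ => (n : ℝ) ^ (2 * α) * c n ^ 2) :
    3 * (∑' n, c n * ∑ p ∈ antidiagonal n, c p.1 * c p.2) -
        2 * ν * (2 * Real.pi) ^ (2 * α) * ∑' n : ℕ, (n : ℝ) ^ (2 * α) * c n ^ 2 ≤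
      sigmaOne ν α * (∑' n, c n ^ 2) ^ gammaOne α := by
  have hA0 : 0 ≤ ∑' n, c n ^ 2 := tsum_nonneg fun n => sq_nonneg _
  have hD0 : 0 ≤ ∑' n : ℕ, (n : ℝ) ^ (2 * α) * c n ^ 2 := tsum_nonneg fun n => by positivity
  have hκ : 0 < 2 * ν * (2 * Real.pi) ^ (2 * α) := by have := Real.pi_pos; positivity
  have hs2 : √2 ≤ 2 := Real.sqrt_le_iff.2 (by norm_num)
  have hW : 0 < 2 - √2 / 3 := by linarith
  rcases le_or_gt (1 / 2) α with h | h
  -- For `α ≥ 1/2` the weights are trivial: `b = 0`, and there are `n - 1 ≤ n` terms.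
  · have ht := tsum_mul_sum_antidiagonal_le (W := 1) (b := 0) (s := 2 * α) zero_le_one
      (fun k => by norm_num) (by linarith) le_rfl zero_le_one (by linarith)
      (by linarith) hc hc0 hA hD
    rw [Real.sqrt_one, one_mul, show 2 * (2 * α) = 4 * α by ring] at ht
    have hy := mul_rpow_sub_mul_le_gammaOne (M := 3) (by norm_num) hκ hα hA0 hD0
    have hσ : (4 * α - 1) * ((3 / (4 * α)) ^ (4 * α) / (2 * ν * (2 * Real.pi) ^ (2 * α))) ^
        (1 / (4 * α - 1)) ≤ sigmaOne ν α := by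
      rcases h.eq_or_lt with rfl | h
      · exact coeff_le_sigmaOne_half hν
      · exact coeff_le_sigmaOne_of_half_lt hν h hα1
    have := mul_le_mul_of_nonneg_right hσ (Real.rpow_nonneg hA0 (gammaOne α))
    linarith
  -- For `α < 1/2`, `b = 1 - 2α` makes `∑ n^{1-b} c²` the dissipation itself, and
  -- `b ≤ 2α` as `α ≥ 1/4`.
  · have ht := tsum_mul_sum_antidiagonal_le (W := 2 - √2 / 3) (b := 1 - 2 * α) (s := 2 * α)
      hW.le (sum_two_div_rpow_add_rpow_le (by linarith)) (by linarith) (by linarith) (by linarith)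
      (by linarith) (by linarith) hc hc0 hA hD
    rw [show 2 * (2 * α) = 4 * α by ring] at ht
    have hy := mul_rpow_sub_mul_le_gammaOne (M := 3 * √(2 - √2 / 3)) (by positivity) hκ hα hA0 hD0
    have := mul_le_mul_of_nonneg_right (coeff_le_sigmaOne_of_lt_half hν hα h)
      (Real.rpow_nonneg hA0 (gammaOne α))
    linarith

/-! ### Series with nonnegative frequencies -/

/-- The character `x ↦ e^{2πinx}` of `ℝ/ℤ`, as a function on `ℝ`. -/
noncomputable def expChar (n : ℤ) (x : ℝ) : ℂ := Complex.exp (2 * Real.pi * Complex.I * n * x)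

theorem continuous_expChar (n : ℤ) : Continuous (expChar n) := by
  unfold expChar; fun_prop

theorem expChar_zero (x : ℝ) : expChar 0 x = 1 := by simp [expChar]

theorem expChar_add (m n : ℤ) (x : ℝ) : expChar (m + n) x = expChar m x * expChar n x := by
  rw [expChar, expChar, expChar, ← Complex.exp_add]
  push_cast
  ring_nf

theorem conj_expChar (n : ℤ) (x : ℝ) : conj (expChar n x) = expChar (-n) x := by
  rw [expChar, expChar, ← Complex.exp_conj]
  simp [map_ofNat]

theorem norm_expChar (n : ℤ) (x : ℝ) : ‖expChar n x‖ = 1 := by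
  rw [expChar, show 2 * (Real.pi : ℂ) * Complex.I * n * x = ((2 * Real.pi * n * x : ℝ) : ℂ) *
    Complex.I by push_cast; ring]
  exact Complex.norm_exp_ofReal_mul_I _

theorem integral_expChar (n : ℤ) : ∫ x in (0 : ℝ)..1, expChar n x = if n = 0 then 1 else 0 := by
  split_ifs with h
  · simp [h, expChar_zero]
  · have hc : 2 * (Real.pi : ℂ) * Complex.I * n ≠ 0 := by
      simp [Real.pi_ne_zero, h]
    have := integral_exp_mul_complex (a := 0) (b := 1) hc
    unfold expChar
    rw [this]
    have h1 : Complex.exp (2 * Real.pi * Complex.I * n * (1 : ℝ)) = 1 := by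
      rw [Complex.exp_eq_one_iff]
      exact ⟨n, by push_cast; ring⟩
    rw [h1]
    simp

theorem coeff_eq_integral (f : ℝ → ℝ) (k : ℤ) :
    coeff f k = ∫ x in (0 : ℝ)..1, expChar (-k) x * f x := by
  rw [coeff, fourierCoeffOn_eq_integral]
  simp only [fourier_coe_apply]
  simp [expChar]

/-- The sum `∑ₙ gₙ e^{2πinx}` over `n ≥ 0`. -/
noncomputable def analyticSeries (g : ℕ → ℂ) (x : ℝ) : ℂ := ∑' n : ℕ, g n * expChar n x

theorem hasSum_analyticSeries {g : ℕ → ℂ} (hg : Summable fun n => ‖g n‖) (x : ℝ) :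
    HasSum (fun n : ℕ => g n * expChar n x) (analyticSeries g x) :=
  (Summable.of_norm (by simpa [norm_expChar] using hg)).hasSum

theorem continuous_analyticSeries {g : ℕ → ℂ} (hg : Summable fun n => ‖g n‖) :
    Continuous (analyticSeries g) :=
  continuous_tsum (fun n => continuous_const.mul (continuous_expChar n)) hg
    (fun n x => by simp [norm_expChar])

theorem hasSum_integral_analyticSeries_mul {g : ℕ → ℂ} (hg : Summable fun n => ‖g n‖) {h : ℝ → ℂ}
    (hh : Continuous h) :
    HasSum (fun n : ℕ => g n * ∫ x in (0 : ℝ)..1, expChar n x * h x)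
      (∫ x in (0 : ℝ)..1, analyticSeries g x * h x) := by
  have := intervalIntegral.hasSum_integral_of_dominated_convergence (a := 0) (b := 1)
    (μ := MeasureTheory.volume)
    (F := fun (n : ℕ) x => g n * expChar n x * h x) (f := fun x => analyticSeries g x * h x)
    (fun n x => ‖g n‖ * ‖h x‖)
    (fun n => ((continuous_const.mul (continuous_expChar n)).mul hh).aestronglyMeasurable)
    (fun n => by simp [norm_expChar])
    (by filter_upwards with x _ using hg.mul_right _)
    (by simp only [tsum_mul_right]; exact (continuous_const.mul hh.norm).intervalIntegrable _ _)
    (by filter_upwards with x _ using (hasSum_analyticSeries hg x).mul_right _)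
  simpa [mul_assoc, intervalIntegral.integral_const_mul] using this

theorem integral_expChar_mul_analyticSeries {g : ℕ → ℂ} (hg : Summable fun n => ‖g n‖) (k : ℤ) :
    ∫ x in (0 : ℝ)..1, expChar k x * analyticSeries g x =
      ∑' n : ℕ, g n * if (n : ℤ) + k = 0 then 1 else 0 := by
  have := (hasSum_integral_analyticSeries_mul hg (continuous_expChar k)).tsum_eq
  simp_rw [← expChar_add, integral_expChar] at this
  rw [this]
  simp_rw [mul_comm]

theorem integral_expChar_neg_mul_analyticSeries {g : ℕ → ℂ} (hg : Summable fun n => ‖g n‖) (k : ℕ) :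
    ∫ x in (0 : ℝ)..1, expChar (-k) x * analyticSeries g x = g k := by
  rw [integral_expChar_mul_analyticSeries hg, tsum_eq_single k]
  · simp
  · intro n hn
    rw [if_neg (by omega), mul_zero]

theorem integral_expChar_natCast_mul_analyticSeries {g : ℕ → ℂ} (hg : Summable fun n => ‖g n‖)
    (hg0 : g 0 = 0) (k : ℕ) :
    ∫ x in (0 : ℝ)..1, expChar k x * analyticSeries g x = 0 := by
  rw [integral_expChar_mul_analyticSeries hg]
  refine (tsum_congr fun n => ?_).trans tsum_zero
  rcases Nat.eq_zero_or_pos n with rfl | hn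
  · simp [hg0]
  · rw [if_neg (by omega), mul_zero]

/-- A product of two analytic series has no constant term if one of the factors has none. -/
theorem integral_analyticSeries_mul_analyticSeries {g h : ℕ → ℂ} (hg : Summable fun n => ‖g n‖)
    (hh : Summable fun n => ‖h n‖) (hh0 : h 0 = 0) :
    ∫ x in (0 : ℝ)..1, analyticSeries g x * analyticSeries h x = 0 := by
  refine (hasSum_integral_analyticSeries_mul hg (continuous_analyticSeries hh)).unique ?_
  simp only [integral_expChar_natCast_mul_analyticSeries hh hh0, mul_zero]
  exact hasSum_zero

theorem intervalIntegral_conj (f : ℝ → ℂ) :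
    ∫ x in (0 : ℝ)..1, conj (f x) = conj (∫ x in (0 : ℝ)..1, f x) := by
  simp only [intervalIntegral.integral_of_le zero_le_one]
  exact integral_conj

theorem hasSum_integral_analyticSeries_mul_conj {g h : ℕ → ℂ} (hg : Summable fun n => ‖g n‖)
    (hh : Summable fun n => ‖h n‖) :
    HasSum (fun n => g n * conj (h n))
      (∫ x in (0 : ℝ)..1, analyticSeries g x * conj (analyticSeries h x)) := by
  convert! hasSum_integral_analyticSeries_mul hg
    (Complex.continuous_conj.comp (continuous_analyticSeries hh)) using 1
  ext n
  rw [← integral_expChar_neg_mul_analyticSeries hh n, ← intervalIntegral_conj]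
  simp [conj_expChar]

theorem analyticSeries_mul {g h : ℕ → ℂ} (hg : Summable fun n => ‖g n‖)
    (hh : Summable fun n => ‖h n‖) (x : ℝ) :
    analyticSeries g x * analyticSeries h x =
      analyticSeries (fun n => ∑ p ∈ antidiagonal n, g p.1 * h p.2) x := by
  unfold analyticSeries
  rw [tsum_mul_tsum_eq_tsum_sum_antidiagonal_of_summable_norm
    (by simpa [norm_expChar] using hg) (by simpa [norm_expChar] using hh)]
  refine tsum_congr fun n => ?_
  rw [sum_mul]
  refine sum_congr rfl fun p hp => ?_
  rw [← mem_antidiagonal.1 hp, Nat.cast_add, expChar_add]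
  ring

/-- For a mean-zero real function `v = F + F̄`, with `F` its analytic half, `∫ F³ = 0` and only the
terms of `v³` mixing `F` and `F̄` contribute to the mean. -/
theorem abs_integral_cube_le {c : ℕ → ℂ} (hc : Summable fun n => ‖c n‖) (hc0 : c 0 = 0)
    {v : ℝ → ℝ} (hv : ∀ x, (v x : ℂ) = analyticSeries c x + conj (analyticSeries c x)) :
    |∫ x in (0 : ℝ)..1, v x ^ 3| ≤
      6 * ∑' n, ‖c n‖ * ∑ p ∈ antidiagonal n, ‖c p.1‖ * ‖c p.2‖ := by
  set F := analyticSeries c with hF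
  set s : ℕ → ℂ := fun n => ∑ p ∈ antidiagonal n, c p.1 * c p.2 with hs
  have hss : Summable fun n => ‖s n‖ := summable_norm_sum_mul_antidiagonal_of_summable_norm hc hc
  have hFc : Continuous F := continuous_analyticSeries hc
  have hFF : ∀ x, F x * F x = analyticSeries s x := analyticSeries_mul hc hc
  -- With `v = 2 Re F`, the identity `4 (Re F)³ = Re F³ + 3 Re (F² F̄)`.
  have h3 : ∀ x, v x ^ 3 = 2 * (F x * F x * F x).re + 6 * (F x * F x * conj (F x)).re := by
    intro x
    have hx : v x = 2 * (F x).re := by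
      have := congrArg Complex.re (hv x)
      rw [Complex.ofReal_re, Complex.add_re, Complex.conj_re] at this
      linarith
    rw [hx]
    simp only [Complex.mul_re, Complex.mul_im, Complex.conj_re, Complex.conj_im]
    ring
  have hre : ∀ G : ℝ → ℂ, Continuous G →
      ∫ x in (0 : ℝ)..1, (G x).re = (∫ x in (0 : ℝ)..1, G x).re := by
    intro G hG
    exact Complex.reCLM.intervalIntegral_comp_comm (hG.intervalIntegrable _ _)
  have c1 : Continuous fun x => F x * F x * F x := (hFc.mul hFc).mul hFc
  have c2 : Continuous fun x => F x * F x * conj (F x) :=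
    (hFc.mul hFc).mul (Complex.continuous_conj.comp hFc)
  have c1' : Continuous fun x => 2 * (F x * F x * F x).re :=
    continuous_const.mul (Complex.continuous_re.comp c1)
  have c2' : Continuous fun x => 6 * (F x * F x * conj (F x)).re :=
    continuous_const.mul (Complex.continuous_re.comp c2)
  have i1 : ∫ x in (0 : ℝ)..1, F x * F x * F x = 0 := by
    simp only [hFF]
    exact integral_analyticSeries_mul_analyticSeries hss hc hc0
  have i2 : HasSum (fun n => s n * conj (c n)) (∫ x in (0 : ℝ)..1, F x * F x * conj (F x)) := by
    simp only [hFF]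
    exact hasSum_integral_analyticSeries_mul_conj hss hc
  have hI : ∫ x in (0 : ℝ)..1, v x ^ 3 = 6 * (∫ x in (0 : ℝ)..1, F x * F x * conj (F x)).re := by
    simp only [h3]
    rw [intervalIntegral.integral_add
      (c1'.intervalIntegrable _ _) (c2'.intervalIntegrable _ _),
      intervalIntegral.integral_const_mul, intervalIntegral.integral_const_mul, hre _ c1, hre _ c2,
      i1]
    simp
  rw [hI, abs_mul, abs_of_pos (by norm_num : (0 : ℝ) < 6)]
  gcongr
  refine (Complex.abs_re_le_norm _).trans ?_
  have hle : ∀ n, ‖s n * conj (c n)‖ ≤ ‖c n‖ * ∑ p ∈ antidiagonal n, ‖c p.1‖ * ‖c p.2‖ := by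
    intro n
    rw [norm_mul, RCLike.norm_conj, mul_comm]
    gcongr
    refine (norm_sum_le _ _).trans (le_of_eq (sum_congr rfl fun p _ => norm_mul _ _))
  have hsum : Summable fun n => ‖c n‖ * ∑ p ∈ antidiagonal n, ‖c p.1‖ * ‖c p.2‖ := by
    have h1 := (summable_norm_sum_mul_antidiagonal_of_summable_norm hc.norm hc.norm)
    have h2 : Summable fun n => ∑ p ∈ antidiagonal n, ‖c p.1‖ * ‖c p.2‖ := h1.of_norm
    refine (h2.mul_left (∑' n, ‖c n‖)).of_nonneg_of_le (fun n => by positivity) fun n => ?_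
    gcongr
    exact hc.le_tsum n fun _ _ => norm_nonneg _
  rw [← i2.tsum_eq]
  exact tsum_of_norm_bounded hsum.hasSum hle

/-! ### Fourier coefficients of periodic functions -/

theorem coeff_neg (f : ℝ → ℝ) (k : ℤ) : coeff f (-k) = conj (coeff f k) := by
  rw [coeff_eq_integral, coeff_eq_integral, ← intervalIntegral_conj]
  simp [conj_expChar]

theorem norm_coeff_neg (f : ℝ → ℝ) (k : ℤ) : ‖coeff f (-k)‖ = ‖coeff f k‖ := by
  rw [coeff_neg, RCLike.norm_conj]

theorem intervalIntegrable_expChar_mul {f : ℝ → ℝ} (hf : Continuous f) (k : ℤ) :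
    IntervalIntegrable (fun x => expChar k x * f x) MeasureTheory.volume 0 1 :=
  ((continuous_expChar k).mul (Complex.continuous_ofReal.comp hf)).intervalIntegrable _ _

theorem coeff_add {f g : ℝ → ℝ} (hf : Continuous f) (hg : Continuous g) (k : ℤ) :
    coeff (fun x => f x + g x) k = coeff f k + coeff g k := by
  simp only [coeff_eq_integral]
  rw [← intervalIntegral.integral_add (intervalIntegrable_expChar_mul hf _)
    (intervalIntegrable_expChar_mul hg _)]
  simp [mul_add]

theorem coeff_sub {f g : ℝ → ℝ} (hf : Continuous f) (hg : Continuous g) (k : ℤ) :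
    coeff (fun x => f x - g x) k = coeff f k - coeff g k := by
  simp only [coeff_eq_integral]
  rw [← intervalIntegral.integral_sub (intervalIntegrable_expChar_mul hf _)
    (intervalIntegrable_expChar_mul hg _)]
  simp [mul_sub]

theorem hasSum_sq_norm_coeff {f : ℝ → ℝ} (hf : Continuous f) :
    HasSum (fun k : ℤ => ‖coeff f k‖ ^ 2) (∫ x in (0 : ℝ)..1, f x ^ 2) := by
  have hc : Continuous fun x => (f x : ℂ) := Complex.continuous_ofReal.comp hf
  have hm : MeasureTheory.MemLp (fun x => (f x : ℂ)) 2
      (MeasureTheory.volume.restrict (Set.Ioc 0 1)) :=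
    (MeasureTheory.memLp_two_iff_integrable_sq_norm hc.aestronglyMeasurable).2
      (hc.norm.pow 2).integrableOn_Ioc
  have := hasSum_sq_fourierCoeffOn (zero_lt_one : (0 : ℝ) < 1) hm
  simpa [coeff] using this

/-- Parseval's identity for the inner product of two real functions, by polarization. -/
theorem hasSum_re_coeff_mul_conj {f g : ℝ → ℝ} (hf : Continuous f) (hg : Continuous g) :
    HasSum (fun k : ℤ => (coeff f k * conj (coeff g k)).re) (∫ x in (0 : ℝ)..1, f x * g x) := by
  have h1 := hasSum_sq_norm_coeff (hf.add hg)
  have h2 := hasSum_sq_norm_coeff (hf.sub hg)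
  have h := (h1.sub h2).mul_left (1 / 4)
  have c1 : Continuous fun x => (f + g) x ^ 2 := (hf.add hg).pow 2
  have c2 : Continuous fun x => (f - g) x ^ 2 := (hf.sub hg).pow 2
  rw [← intervalIntegral.integral_sub (c1.intervalIntegrable _ _)
    (c2.intervalIntegrable _ _), ← intervalIntegral.integral_const_mul] at h
  convert! h using 1
  · ext k
    rw [show f + g = fun x => f x + g x from rfl, show f - g = fun x => f x - g x from rfl,
      coeff_add hf hg, coeff_sub hf hg, Complex.sq_norm, Complex.sq_norm,
      Complex.normSq_add, Complex.normSq_sub]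
    ring
  · congr 1
    ext x
    simp only [Pi.add_apply, Pi.sub_apply]
    ring

theorem coeff_deriv {f : ℝ → ℝ} (hf : ContDiff ℝ 1 f) (hp : Function.Periodic f 1) (k : ℤ) :
    coeff (deriv f) k = 2 * Real.pi * Complex.I * k * coeff f k := by
  have hd : ∀ x, HasDerivAt f (deriv f x) x := fun x =>
    (hf.differentiable (by norm_num) x).hasDerivAt
  have hc : Continuous (deriv f) := hf.continuous_deriv le_rfl
  have h01 : f 1 = f 0 := by simpa using hp 0
  rcases eq_or_ne k 0 with rfl | hk
  · rw [coeff_eq_integral]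
    simp only [neg_zero, expChar_zero, one_mul, Int.cast_zero, mul_zero, zero_mul]
    rw [intervalIntegral.integral_ofReal,
      intervalIntegral.integral_deriv_eq_sub (fun x _ => (hd x).differentiableAt)
        (hc.intervalIntegrable _ _), h01]
    simp
  · have := fourierCoeffOn_of_hasDerivAt (zero_lt_one : (0 : ℝ) < 1)
      (f := fun x => (f x : ℂ)) (f' := fun x => ((deriv f x : ℝ) : ℂ)) hk
      (fun x _ => (hd x).ofReal_comp)
      ((Complex.continuous_ofReal.comp hc).intervalIntegrable _ _)
    have hkc : (k : ℂ) ≠ 0 := by exact_mod_cast hk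
    have hpi : (Real.pi : ℂ) ≠ 0 := by exact_mod_cast Real.pi_ne_zero
    rw [h01, sub_self, mul_zero] at this
    rw [coeff, coeff, this]
    field_simp
    simp

theorem coeff_deriv_zero {f : ℝ → ℝ} (hf : ContDiff ℝ 1 f) (hp : Function.Periodic f 1) :
    coeff (deriv f) 0 = 0 := by
  simp [coeff_deriv hf hp]

theorem periodic_deriv {f : ℝ → ℝ} (hp : Function.Periodic f 1) :
    Function.Periodic (deriv f) 1 := fun x => by
  rw [← deriv_comp_add_const f 1 x, show (fun y => f (y + 1)) = f from funext hp]

theorem contDiff_one_deriv {f : ℝ → ℝ} (hf : ContDiff ℝ 2 f) : ContDiff ℝ 1 (deriv f) :=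
  (contDiff_succ_iff_deriv.1 hf).2.2

/-- The coefficients of a `C¹` function are absolutely summable:
`|f̂ₖ| ≤ |k f̂ₖ|² + 1/k²` for `k ≠ 0`. -/
theorem summable_norm_coeff {f : ℝ → ℝ} (hf : ContDiff ℝ 1 f) (hp : Function.Periodic f 1) :
    Summable fun k : ℤ => ‖coeff f k‖ := by
  have h1 := (hasSum_sq_norm_coeff (hf.continuous_deriv le_rfl)).summable
  have h2 : Summable fun k : ℤ => 1 / (k : ℝ) ^ 2 := Real.summable_one_div_int_pow.2 one_lt_two
  -- This term covers `k = 0`, where `1 / k ^ 2` has the junk value `0`.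
  have h3 : Summable fun k : ℤ => if k = 0 then ‖coeff f 0‖ else 0 :=
    (hasSum_ite_eq 0 _).summable
  refine ((h1.add h2).add h3).of_nonneg_of_le (fun k => norm_nonneg _) fun k => ?_
  rcases eq_or_ne k 0 with rfl | hk
  · rw [if_pos rfl]
    have : 0 ≤ ‖coeff (deriv f) 0‖ ^ 2 + 1 / ((0 : ℤ) : ℝ) ^ 2 := by positivity
    linarith
  · rw [if_neg hk, add_zero, coeff_deriv hf hp, norm_mul, mul_pow]
    have hk1 : 0 < |(k : ℝ)| := abs_pos.2 (by exact_mod_cast hk)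
    have hn : ‖2 * (Real.pi : ℂ) * Complex.I * k‖ = 2 * Real.pi * |(k : ℝ)| := by
      simp [abs_of_pos Real.pi_pos]
    rw [hn, ← sq_abs (k : ℝ)]
    have hle : |(k : ℝ)| * ‖coeff f k‖ ≤ 2 * Real.pi * |(k : ℝ)| * ‖coeff f k‖ := by
      have := Real.pi_gt_three
      have h0 : 0 ≤ |(k : ℝ)| * ‖coeff f k‖ := by positivity
      nlinarith
    have hsq : (|(k : ℝ)| * ‖coeff f k‖) ^ 2 ≤ (2 * Real.pi * |(k : ℝ)| * ‖coeff f k‖) ^ 2 := by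
      gcongr
    have hyoung : ‖coeff f k‖ ≤ (|(k : ℝ)| * ‖coeff f k‖) ^ 2 + 1 / |(k : ℝ)| ^ 2 := by
      have hx : ‖coeff f k‖ = (|(k : ℝ)| * ‖coeff f k‖) * (1 / |(k : ℝ)|) := by field_simp
      have hy : (1 / |(k : ℝ)|) ^ 2 = 1 / |(k : ℝ)| ^ 2 := by rw [div_pow, one_pow]
      rw [← hy]
      nlinarith [sq_nonneg (|(k : ℝ)| * ‖coeff f k‖ - 1 / |(k : ℝ)|),
        sq_nonneg (|(k : ℝ)| * ‖coeff f k‖), sq_nonneg (1 / |(k : ℝ)|)]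
    rw [mul_pow] at hsq
    linarith

theorem hasSum_coeff_mul_expChar {f : ℝ → ℝ} (hf : ContDiff ℝ 1 f) (hp : Function.Periodic f 1)
    (x : ℝ) : HasSum (fun k : ℤ => coeff f k * expChar k x) (f x) := by
  have hp' : Function.Periodic (fun x => (f x : ℂ)) 1 := fun y => by simp [hp y]
  have hcont : Continuous fun x => (f x : ℂ) := Complex.continuous_ofReal.comp hf.continuous
  let F : C(AddCircle (1 : ℝ), ℂ) := ⟨hp'.lift, continuous_coinduced_dom.2 hcont⟩
  have hF : ∀ k, fourierCoeff F k = coeff f k := fun k => by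
    rw [fourierCoeff_eq_intervalIntegral _ _ 0, coeff_eq_integral]
    simp only [fourier_coe_apply]
    simp [F, expChar]
  have hs : Summable (fourierCoeff F) := by
    rw [show fourierCoeff F = coeff f from funext hF]
    exact (summable_norm_coeff hf hp).of_norm
  have := has_pointwise_sum_fourier_series_of_summable hs (x : AddCircle (1 : ℝ))
  simp only [fourier_coe_apply, hF] at this
  simpa [F, expChar] using this

theorem summable_norm_coeff_nat {f : ℝ → ℝ} (hf : ContDiff ℝ 1 f) (hp : Function.Periodic f 1) :
    Summable fun n : ℕ => ‖coeff f n‖ :=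
  (summable_norm_coeff hf hp).comp_injective Nat.cast_injective

/-- A real mean-zero function is twice the real part of its analytic half. -/
theorem eq_analyticSeries_add_conj {f : ℝ → ℝ} (hf : ContDiff ℝ 1 f) (hp : Function.Periodic f 1)
    (h0 : coeff f 0 = 0) (x : ℝ) :
    (f x : ℂ) = analyticSeries (fun n => coeff f n) x +
      conj (analyticSeries (fun n => coeff f n) x) := by
  have h1 := (hasSum_coeff_mul_expChar hf hp x).nat_add_neg
  have h2 := hasSum_analyticSeries (summable_norm_coeff_nat hf hp) x
  have h3 := h2.add (Complex.hasSum_conj'.2 h2)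
  simp only [h0, zero_mul, add_zero] at h1
  refine h1.unique ?_
  convert! h3 using 2 with n
  rw [coeff_neg, map_mul, conj_expChar]

theorem hasSum_nat_of_even {F : ℤ → ℝ} {S : ℝ} (hF : HasSum F S) (heven : ∀ k, F (-k) = F k)
    (h0 : F 0 = 0) : HasSum (fun n : ℕ => F n) (S / 2) := by
  have h := hF.nat_add_neg
  simp only [heven, h0, add_zero] at h
  convert! h.div_const 2 using 2
  ring

/-- Parseval for `f'`. The factor `1/2` in the enstrophy is absorbed by keeping only `n ≥ 0`, the
coefficients being even in modulus and zero at `n = 0`. -/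
theorem hasSum_enstrophy {f : ℝ → ℝ} (hf : ContDiff ℝ 2 f) (hp : Function.Periodic f 1) :
    HasSum (fun n : ℕ => ‖coeff (deriv f) n‖ ^ 2) (enstrophy f) := by
  have h := hasSum_nat_of_even (hasSum_sq_norm_coeff (hf.continuous_deriv (by norm_num)))
    (fun k => by rw [norm_coeff_neg])
    (by rw [coeff_deriv_zero (hf.of_le (by norm_num)) hp]; simp)
  convert! h using 1
  simp only [enstrophy, sq_abs]
  ring

/-- The dissipation `-∫ (-Δ)^α f · f''` in terms of the coefficients of `f'`, by Parseval; neither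
factor needs an absolutely convergent Fourier series. -/
theorem hasSum_integral_fracLaplacian_mul {α : ℝ} (hα : 0 < α) {f w : ℝ → ℝ} (hf : ContDiff ℝ 2 f)
    (hp : Function.Periodic f 1) (hw : IsFracLaplacian α f w) :
    HasSum (fun n : ℕ => (n : ℝ) ^ (2 * α) * ‖coeff (deriv f) n‖ ^ 2)
      (-(∫ x in (0 : ℝ)..1, w x * deriv (deriv f) x) / (2 * (2 * Real.pi) ^ (2 * α))) := by
  have hf1 := contDiff_one_deriv hf
  have h := hasSum_re_coeff_mul_conj hw.continuous (hf1.continuous_deriv le_rfl)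
  have hk : ∀ k : ℤ, (coeff w k * conj (coeff (deriv (deriv f)) k)).re =
      -((2 * Real.pi * |(k : ℝ)|) ^ (2 * α) * ‖coeff (deriv f) k‖ ^ 2) := by
    intro k
    rw [hw.coeff_eq, coeff_deriv hf1 (periodic_deriv hp)]
    have hd := coeff_deriv (hf.of_le (by norm_num)) hp k
    have e : conj (2 * (Real.pi : ℂ) * Complex.I * k * coeff (deriv f) k) =
        -(2 * (Real.pi : ℂ) * Complex.I * k) * conj (coeff (deriv f) k) := by
      simp [map_ofNat]
    rw [e, show ∀ a b c d : ℂ, a * b * (-c * d) = -(a * ((c * b) * d)) by intros; ring, ← hd,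
      Complex.mul_conj, Complex.normSq_eq_norm_sq]
    norm_cast
  simp only [hk] at h
  have hπ := Real.pi_pos
  have h2 := hasSum_nat_of_even h (fun k => by simp [norm_coeff_neg])
    (by simp [Real.zero_rpow (by linarith : 2 * α ≠ 0)])
  convert! h2.mul_left (-1 / (2 * Real.pi) ^ (2 * α)) using 1
  · ext n
    rw [Int.cast_natCast, abs_of_nonneg n.cast_nonneg,
      Real.mul_rpow (y := (n : ℝ)) (by positivity) (by positivity)]
    field_simp
  · field_simp

/-! ### Evolution of the enstrophy -/

theorem integral_deriv_eq_zero_of_periodic {f f' : ℝ → ℝ} (hf : ∀ x, HasDerivAt f (f' x) x)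
    (hf' : Continuous f') (hp : Function.Periodic f 1) : ∫ x in (0 : ℝ)..1, f' x = 0 := by
  rw [intervalIntegral.integral_eq_sub_of_hasDerivAt (fun x _ => hf x)
    (hf'.intervalIntegrable _ _), show f 1 = f 0 by simpa using hp 0, sub_self]

theorem hasDerivAt_deriv_of_contDiff_two {f : ℝ → ℝ} (hf : ContDiff ℝ 2 f) (x : ℝ) :
    HasDerivAt f (deriv f x) x ∧ HasDerivAt (deriv f) (deriv (deriv f) x) x :=
  ⟨(hf.differentiable (by norm_num) x).hasDerivAt,
    ((contDiff_one_deriv hf).differentiable (by norm_num) x).hasDerivAt⟩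

theorem continuous_deriv_deriv {f : ℝ → ℝ} (hf : ContDiff ℝ 2 f) :
    Continuous (deriv (deriv f)) :=
  (contDiff_one_deriv hf).continuous_deriv le_rfl

/-- Integrating by parts moves one derivative off the difference `f - g`, so that difference
quotients of the enstrophy in time involve no mixed derivative `u_{xt}`. -/
theorem enstrophy_sub_enstrophy {f g : ℝ → ℝ} (hf : ContDiff ℝ 2 f) (hg : ContDiff ℝ 2 g)
    (hpf : Function.Periodic f 1) (hpg : Function.Periodic g 1) :
    enstrophy f - enstrophy g =
      ∫ x in (0 : ℝ)..1, (f x - g x) * (-(1 / 2) * (deriv (deriv f) x + deriv (deriv g) x)) := by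
  have cf := hf.continuous
  have cg := hg.continuous
  have cf1 := hf.continuous_deriv (by norm_num)
  have cg1 := hg.continuous_deriv (by norm_num)
  have cf2 := continuous_deriv_deriv hf
  have cg2 := continuous_deriv_deriv hg
  have h0 := integral_deriv_eq_zero_of_periodic
    (f := fun x => (f x - g x) * (deriv f x + deriv g x))
    (fun x => (((hasDerivAt_deriv_of_contDiff_two hf x).1.sub
      (hasDerivAt_deriv_of_contDiff_two hg x).1).mul
      ((hasDerivAt_deriv_of_contDiff_two hf x).2.add
      (hasDerivAt_deriv_of_contDiff_two hg x).2))) (by simp only [Pi.sub_apply]; fun_prop)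
    (fun x => by simp only [hpf x, hpg x, periodic_deriv hpf x, periodic_deriv hpg x])
  have e : enstrophy f - enstrophy g =
      (1 / 2) * ∫ x in (0 : ℝ)..1, (|deriv f x| ^ 2 - |deriv g x| ^ 2) := by
    rw [intervalIntegral.integral_sub (Continuous.intervalIntegrable (by fun_prop) _ _)
      (Continuous.intervalIntegrable (by fun_prop) _ _), enstrophy, enstrophy]
    ring
  rw [e, ← sub_eq_zero, ← intervalIntegral.integral_const_mul, ← intervalIntegral.integral_sub
    (Continuous.intervalIntegrable (by fun_prop) _ _)
    (Continuous.intervalIntegrable (by fun_prop) _ _)]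
  have h1 := congrArg ((1 / 2 : ℝ) * ·) h0
  rw [mul_zero, ← intervalIntegral.integral_const_mul] at h1
  rw [← h1]
  congr 1
  ext x
  simp only [sq_abs, Pi.sub_apply]
  ring

/-- The enstrophy is differentiable in time, with derivative `-∫ u_t u_xx`, by dominated convergence
for the difference quotients given by `enstrophy_sub_enstrophy`. -/
theorem hasDerivAt_enstrophy {ν α T : ℝ} {u : ℝ → ℝ → ℝ} (hu : IsClassicalSolution ν α T u)
    {t : ℝ} (ht : t ∈ Set.Ioo 0 T) :
    HasDerivAt (fun s => enstrophy (u s))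
      (-∫ x in (0 : ℝ)..1, deriv (fun s => u s x) t * deriv (deriv (u t)) x) t := by
  obtain ⟨δ, hδ, hδT⟩ := Metric.nhds_basis_closedBall.mem_iff.1 (Ioo_mem_nhds ht.1 ht.2)
  have hK : IsCompact (Metric.closedBall t δ ×ˢ Set.Icc (0 : ℝ) 1) :=
    (isCompact_closedBall t δ).prod isCompact_Icc
  have hKs : Metric.closedBall t δ ×ˢ Set.Icc (0 : ℝ) 1 ⊆ Set.Ioo 0 T ×ˢ Set.univ :=
    Set.prod_mono hδT (Set.subset_univ _)
  obtain ⟨C₁, hC₁⟩ := hK.exists_bound_of_continuousOn (hu.continuous_ut.mono hKs)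
  obtain ⟨C₂, hC₂⟩ := hK.exists_bound_of_continuousOn (hu.continuous_uxx.mono hKs)
  have htδ : t ∈ Metric.closedBall t δ := Metric.mem_closedBall_self hδ.le
  have hev : ∀ᶠ s in 𝓝[≠] t, s ∈ Metric.closedBall t δ :=
    nhdsWithin_le_nhds (Metric.closedBall_mem_nhds t hδ)
  rw [hasDerivAt_iff_tendsto_slope]
  have hslope : ∀ᶠ s in 𝓝[≠] t, ∫ x in (0 : ℝ)..1, slope (fun s => u s x) t s *
      (-(1 / 2) * (deriv (deriv (u s)) x + deriv (deriv (u t)) x)) =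
      slope (fun s => enstrophy (u s)) t s := by
    filter_upwards [hev] with s hs
    rw [slope_def_field, enstrophy_sub_enstrophy (hu.contDiff_space s (hδT hs))
      (hu.contDiff_space t ht) (hu.periodic s (hδT hs)) (hu.periodic t ht),
      ← intervalIntegral.integral_div]
    congr 1
    ext x
    rw [slope_def_field]
    ring
  refine Tendsto.congr' hslope ?_
  have hlim : (-∫ x in (0 : ℝ)..1, deriv (fun s => u s x) t * deriv (deriv (u t)) x) =
      ∫ x in (0 : ℝ)..1, deriv (fun s => u s x) t *
        (-(1 / 2) * (deriv (deriv (u t)) x + deriv (deriv (u t)) x)) := by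
    rw [← intervalIntegral.integral_neg]
    congr 1
    ext x
    ring
  rw [hlim]
  refine intervalIntegral.tendsto_integral_filter_of_dominated_convergence
    (fun _ => C₁ * (1 / 2 * (C₂ + C₂))) ?_ ?_ intervalIntegrable_const ?_
  · filter_upwards [hev] with s hs
    have h1 := hu.contDiff_space s (hδT hs)
    have h2 := hu.contDiff_space t ht
    have c1 := h1.continuous
    have c2 := h2.continuous
    have c3 := continuous_deriv_deriv h1
    have c4 := continuous_deriv_deriv h2
    simp only [slope_def_field]
    exact Continuous.aestronglyMeasurable (by fun_prop)
  · filter_upwards [hev] with s hs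
    filter_upwards with x hx
    have hx' : x ∈ Set.Icc (0 : ℝ) 1 := by
      rw [Set.uIoc_of_le zero_le_one] at hx; exact Set.Ioc_subset_Icc_self hx
    have hC10 : 0 ≤ C₁ := (norm_nonneg _).trans (hC₁ (t, x) ⟨htδ, hx'⟩)
    have b1 : ‖u s x - u t x‖ ≤ C₁ * ‖s - t‖ :=
      (convex_closedBall t δ).norm_image_sub_le_of_norm_deriv_le (f := fun s => u s x)
        (fun r hr => hu.differentiable_time r (hδT hr) x) (fun r hr => hC₁ (r, x) ⟨hr, hx'⟩) htδ hs
    have b2 : ‖slope (fun s => u s x) t s‖ ≤ C₁ := by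
      rw [slope_def_field, norm_div]
      exact div_le_of_le_mul₀ (norm_nonneg _) hC10 b1
    have b3 := hC₂ (s, x) ⟨hs, hx'⟩
    have b4 := hC₂ (t, x) ⟨htδ, hx'⟩
    rw [norm_mul, norm_mul]
    gcongr
    · norm_num
    · exact (norm_add_le _ _).trans (add_le_add b3 b4)
  · filter_upwards with x _
    have l1 := hasDerivAt_iff_tendsto_slope.1 (hu.differentiable_time t ht x).hasDerivAt
    have hmem : Set.Ioo 0 T ×ˢ (Set.univ : Set ℝ) ∈ 𝓝 (t, x) :=
      prod_mem_nhds (Ioo_mem_nhds ht.1 ht.2) univ_mem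
    have l2 : Tendsto (fun s => deriv (deriv (u s)) x) (𝓝 t) (𝓝 (deriv (deriv (u t)) x)) :=
      (ContinuousAt.tendsto (hu.continuous_uxx.continuousAt hmem)).comp
        (Continuous.tendsto (f := fun s : ℝ => (s, x)) (by fun_prop) t)
    exact l1.mul (((l2.mono_left nhdsWithin_le_nhds).add_const _).const_mul _)

/-- The enstrophy balance `dE/dt = -½ ∫ u_x³ + ν ∫ (-Δ)^α u · u_xx`. -/
theorem neg_integral_ut_mul_uxx {ν α T : ℝ} {u : ℝ → ℝ → ℝ} (hu : IsClassicalSolution ν α T u)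
    {t : ℝ} (ht : t ∈ Set.Ioo 0 T) {w : ℝ → ℝ} (hw : Continuous w)
    (heq : ∀ x : ℝ, deriv (fun s => u s x) t + u t x * deriv (u t) x + ν * w x = 0) :
    (-∫ x in (0 : ℝ)..1, deriv (fun s => u s x) t * deriv (deriv (u t)) x) =
      -(1 / 2) * (∫ x in (0 : ℝ)..1, deriv (u t) x ^ 3) +
        ν * ∫ x in (0 : ℝ)..1, w x * deriv (deriv (u t)) x := by
  have hf := hu.contDiff_space t ht
  have hp := hu.periodic t ht
  generalize u t = f at *
  have c0 := hf.continuous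
  have c1 := hf.continuous_deriv (by norm_num)
  have c2 := continuous_deriv_deriv hf
  -- `f f' f''` is `((f f'^2)' - f'^3) / 2`.
  have h0 := integral_deriv_eq_zero_of_periodic (f := fun x => f x * (deriv f x) ^ 2)
    (fun x => (hasDerivAt_deriv_of_contDiff_two hf x).1.mul
      ((hasDerivAt_deriv_of_contDiff_two hf x).2.pow 2)) (by simp only [Pi.pow_apply]; fun_prop)
    (fun x => by simp only [hp x, periodic_deriv hp x])
  have e : ∀ x, deriv (fun s => u s x) t * deriv (deriv f) x =
      (1 / 2) * deriv f x ^ 3 - ν * (w x * deriv (deriv f) x) -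
        (1 / 2) * (deriv f x * deriv f x ^ 2 + f x * (2 * deriv f x * deriv (deriv f) x)) := by
    intro x
    rw [show deriv (fun s => u s x) t = -(f x * deriv f x) - ν * w x by linarith [heq x]]
    ring
  simp only [e]
  rw [intervalIntegral.integral_sub (Continuous.intervalIntegrable (by fun_prop) _ _)
    (Continuous.intervalIntegrable (by fun_prop) _ _),
    intervalIntegral.integral_sub (Continuous.intervalIntegrable (by fun_prop) _ _)
    (Continuous.intervalIntegrable (by fun_prop) _ _), intervalIntegral.integral_const_mul,
    intervalIntegral.integral_const_mul, intervalIntegral.integral_const_mul]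
  have h1 : ∫ x in (0 : ℝ)..1,
      (deriv f x * deriv f x ^ 2 + f x * (2 * deriv f x * deriv (deriv f) x)) = 0 := by
    rw [← h0]
    congr 1
    ext x
    simp
  rw [h1]
  ring

end FracBurgers

theorem theorem1 (ν : ℝ) (hν : 0 < ν) (α : ℝ) (hα : 1 / 4 < α ∧ α ≤ 1)
    (T : ℝ) (u : ℝ → ℝ → ℝ) (hu : FracBurgers.IsClassicalSolution ν α T u)
    (t : ℝ) (ht : 0 < t ∧ t < T) :
    DifferentiableAt ℝ (fun s => FracBurgers.enstrophy (u s)) t ∧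
      deriv (fun s => FracBurgers.enstrophy (u s)) t ≤
        FracBurgers.sigmaOne ν α * FracBurgers.enstrophy (u t) ^ FracBurgers.gammaOne α := by
  have hd := FracBurgers.hasDerivAt_enstrophy hu ht
  refine ⟨hd.differentiableAt, ?_⟩
  obtain ⟨w, hw, heq⟩ := hu.equation t ht
  rw [hd.deriv, FracBurgers.neg_integral_ut_mul_uxx hu ht hw.continuous heq]
  have hf := hu.contDiff_space t ht
  have hp := hu.periodic t ht
  have hf1 := FracBurgers.contDiff_one_deriv hf
  have hp1 := FracBurgers.periodic_deriv hp
  have hc0 : FracBurgers.coeff (deriv (u t)) 0 = 0 :=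
    FracBurgers.coeff_deriv_zero (hf.of_le (by norm_num)) hp
  have hE := FracBurgers.hasSum_enstrophy hf hp
  have hD := FracBurgers.hasSum_integral_fracLaplacian_mul (by linarith [hα.1]) hf hp hw
  have hcube := FracBurgers.abs_integral_cube_le (FracBurgers.summable_norm_coeff_nat hf1 hp1) hc0
    (FracBurgers.eq_analyticSeries_add_conj hf1 hp1 hc0)
  have hmain := FracBurgers.three_mul_tsum_sub_le hν hα.1 hα.2
    (c := fun n : ℕ => ‖FracBurgers.coeff (deriv (u t)) n‖) (by simp [hc0])
    (fun n => norm_nonneg _) hE.summable hD.summable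
  rw [hE.tsum_eq, hD.tsum_eq] at hmain
  have hπ : 0 < (2 * Real.pi) ^ (2 * α) := Real.rpow_pos_of_pos (by linarith [Real.pi_pos]) _
  have hdiss : 2 * ν * (2 * Real.pi) ^ (2 * α) *
      (-(∫ x in (0 : ℝ)..1, w x * deriv (deriv (u t)) x) / (2 * (2 * Real.pi) ^ (2 * α))) =
      -(ν * ∫ x in (0 : ℝ)..1, w x * deriv (deriv (u t)) x) := by
    field_simp
  rw [hdiss] at hmain
  have := (abs_le.1 hcube).1
  linarith
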